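/- A partition of a nonnegative integer $n$ is a finite nonincreasing sequence $\lambda=(\lambda_1,\dots,\lambda_r)$ of positive integers with sum $n$ (for $n=0$ there is only the empty partition). Let $l_o(\lambda)$ denote the number of odd parts of $\lambda$ and $r_2(\lambda)$ the number of parts of $\lambda$ congruent to $2$ modulo $4$, both counted with multiplicity. Let $\mathcal{A}_1(n)$ be the set of partitions of $n$ such that: (1) only parts divisible by $2$ may be repeated; (2) the difference between successive parts is at most $4$, and strictly less than $4$ if either of the two parts is divisible by $2$; (3) the smallest part, if there is one, is less than $4$. Let $\mathcal{A}_2(n)$ be the set of partitions of $n$ such that: (1) no part is divisible by $4$; (2) only parts divisible by $2$ may be repeated. Theorem. For every integer $n\ge 0$ there is a bijection $\phi:\mathcal{A}_1(n)\to\mathcal{A}_2(n)$ such that, for every $\alpha\in\mathcal{A}_1(n)$ and $\beta=\phi(\alpha)$, $$l_o(\alpha)=l_o(\beta),\qquad r_2(\alpha)=r_2(\beta).$$ -/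

import Mathlib

namespace EulerRefinement

/-- The parts of a partition listed in nonincreasing order. -/
def partsList {n : ℕ} (p : Nat.Partition n) : List ℕ :=
  p.parts.sort (fun a b => b ≤ a)

/-- Only even parts may be repeated. -/
def OnlyEvenRepeat {n : ℕ} (p : Nat.Partition n) : Prop :=
  ∀ i ∈ p.parts, 2 ≤ p.parts.count i → 2 ∣ i

/-- Successive parts `a ≥ b` satisfy `a - b ≤ 4`, and `a - b < 4` if `a` or `b` is even.
The inequalities are written additively to avoid truncated subtraction. -/
def SmallGaps {n : ℕ} (p : Nat.Partition n) : Prop :=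
  (partsList p).IsChain (fun a b => a ≤ b + 4 ∧ (2 ∣ a ∨ 2 ∣ b → a < b + 4))

/-- The smallest part (if there is any part) is less than `4`. -/
def SmallestLtFour {n : ℕ} (p : Nat.Partition n) : Prop :=
  ∀ x ∈ p.parts, (∀ y ∈ p.parts, x ≤ y) → x < 4

/-- The set `𝒜₁(n)`. -/
def A₁ (n : ℕ) : Set (Nat.Partition n) :=
  {p | OnlyEvenRepeat p ∧ SmallGaps p ∧ SmallestLtFour p}

/-- The set `𝒜₂(n)`. -/
def A₂ (n : ℕ) : Set (Nat.Partition n) :=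
  {p | (∀ i ∈ p.parts, ¬ 4 ∣ i) ∧ OnlyEvenRepeat p}

/-- The number of odd parts, counted with multiplicity. -/
def lo {n : ℕ} (p : Nat.Partition n) : ℕ :=
  p.parts.countP (fun i => i % 2 = 1)

/-- The number of parts congruent to `2` modulo `4`, counted with multiplicity. -/
def r₂ {n : ℕ} (p : Nat.Partition n) : ℕ :=
  p.parts.countP (fun i => i % 4 = 2)

end EulerRefinement

/-!
Read the parts in ascending order. Given a part `p` and a residue `c ≠ 0` modulo `4`, there is a least
number `next p c` congruent to `c` that may follow `p` in a partition where odd parts are distinct.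

* In `𝒜₁` the gap conditions say exactly that every part is the least admissible one with its residue
  (the bound on the smallest part is the gap condition after a fictitious part `0`). So an element of
  `𝒜₁` is a word in the residues `0, 1, 2, 3` not beginning with `0`; equivalently, it consists of
  letters `cᵢ ∈ {1, 2, 3}` and numbers `kᵢ ≥ 0` of zeros in the slot following the letter `cᵢ`
  (`encode₁`, `decode₁`).
* In `𝒜₂` no residue is `0`, but each part may exceed the least admissible value by any multiple
  `4 mᵢ`. So an element of `𝒜₂` consists of letters `cᵢ ∈ {1, 2, 3}` and numbers `mᵢ ≥ 0`
  (`encode₂`, `decode₂`).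

The letters determine the number of odd parts and the number of parts congruent to `2`, so it is
enough to find, for fixed letters `c₁, …, cᵣ`, a bijection `k ↦ m` that preserves the size. The
excess `mᵢ` raises `r - i + 1` parts by `4`, so it contributes `4 (r - i + 1) mᵢ` (`stairWeight`).
The contribution of `k` is `slotWeight`: zeros in a slot contribute their own value, and if the next
letter could otherwise have been reached without passing a multiple of `4`, the first of them also
raises all later letters by `4`. In terms of generating functions, if the first slot can receive the
part `4h` and `t` lists the types of the slots, the series `F(h, t)` of `slotWeight` satisfies
`F(h, false :: t) = F(h + 1, t) / (1 - q ^ h)` and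
`F(h, true :: t) = F(h, t) + q ^ (h + |t|) F(h + 1, t) / (1 - q ^ h)`, so by induction
`F(h, t) = ∏_{j < |t|} 1 / (1 - q ^ (h + j))`, whatever the types are. The bijection `slotMap` is this
induction made explicit (`stairWeight_slotMap`, `slotInv_slotMap`, `slotMap_slotInv`); in the second
recursion the two summands are the lists `m` with first entry zero and nonzero.
-/

namespace EulerRefinement

/-! ### Ascending lists of parts -/

/-- The relation between successive parts, in ascending order, of a partition in which only even
parts may be repeated. -/
def Step₂ (a b : ℕ) : Prop := a ≤ b ∧ (a = b → 2 ∣ a)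

/-- The relation between successive parts, in ascending order, of a partition in `𝒜₁`. -/
def Step₁ (a b : ℕ) : Prop := Step₂ a b ∧ b ≤ a + 4 ∧ (2 ∣ b ∨ 2 ∣ a → b < a + 4)

/-- The ascending lists of parts of the elements of `𝒜₁(n)`. Prefixing the even number `0` turns
the bound on the smallest part into a bound on a gap. -/
def lists₁ (n : ℕ) : Set (List ℕ) :=
  {l | (0 :: l).IsChain Step₁ ∧ (∀ x ∈ l, 0 < x) ∧ l.sum = n}

/-- The ascending lists of parts of the elements of `𝒜₂(n)`. -/
def lists₂ (n : ℕ) : Set (List ℕ) :=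
  {l | (0 :: l).IsChain Step₂ ∧ (∀ x ∈ l, ¬ 4 ∣ x) ∧ l.sum = n}

instance : IsTrans ℕ Step₂ where
  trans a b c := by unfold Step₂; grind

theorem isChain_step₂_iff (l : List ℕ) :
    l.IsChain Step₂ ↔ l.Pairwise (· ≤ ·) ∧ ∀ i ∈ l, 2 ≤ l.count i → 2 ∣ i := by
  rw [List.isChain_iff_pairwise]
  induction l with
  | nil => simp
  | cons a l ih =>
    rw [List.pairwise_cons, List.pairwise_cons, ih]
    constructor
    · rintro ⟨h1, h2, h3⟩
      refine ⟨⟨fun b hb => (h1 b hb).1, h2⟩, fun i hi hc => ?_⟩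
      by_cases hia : i = a
      · subst hia
        rw [List.count_cons_self] at hc
        have : i ∈ l := List.count_pos_iff.1 (by omega)
        exact (h1 i this).2 rfl
      · rw [List.count_cons_of_ne (Ne.symm hia)] at hc
        exact h3 i ((List.mem_cons.1 hi).resolve_left hia) hc
    · rintro ⟨⟨h1, h2⟩, h3⟩
      refine ⟨fun b hb => ⟨h1 b hb, ?_⟩, h2, fun i hi hc => h3 i (List.mem_cons_of_mem _ hi)
        (hc.trans (List.count_le_count_cons))⟩
      rintro rfl
      refine h3 a List.mem_cons_self ?_
      rw [List.count_cons_self]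
      have := List.count_pos_iff.2 hb
      omega

theorem isChain_zero_cons_step₂_iff (l : List ℕ) :
    (0 :: l).IsChain Step₂ ↔ l.IsChain Step₂ := by
  cases l <;> simp [Step₂]

theorem isChain_step₁_iff (l : List ℕ) :
    l.IsChain Step₁ ↔ l.IsChain Step₂ ∧
      l.IsChain (fun a b => b ≤ a + 4 ∧ (2 ∣ b ∨ 2 ∣ a → b < a + 4)) := by
  induction l with
  | nil => simp
  | cons a l ih =>
    cases l with
    | nil => simp
    | cons b l =>
      simp only [List.isChain_cons_cons, ih, Step₁]
      tauto

theorem isChain_zero_cons_step₁_iff (l : List ℕ) :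
    (0 :: l).IsChain Step₁ ↔ l.IsChain Step₁ ∧ ∀ x ∈ l.head?, x < 4 := by
  cases l with
  | nil => simp
  | cons a l =>
    simp only [List.isChain_cons_cons, Step₁, Step₂, List.head?_cons, Option.mem_some_iff,
      forall_eq']
    constructor
    · rintro ⟨h, h'⟩
      exact ⟨h', by omega⟩
    · rintro ⟨h, h'⟩
      exact ⟨by omega, h⟩

/-- The parts of a partition in ascending order. -/
def ascParts {n : ℕ} (p : Nat.Partition n) : List ℕ := (partsList p).reverse

theorem coe_ascParts {n : ℕ} (p : Nat.Partition n) : (ascParts p : Multiset ℕ) = p.parts := by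
  rw [ascParts, Multiset.coe_reverse, partsList, Multiset.sort_eq]

theorem mem_ascParts {n : ℕ} {p : Nat.Partition n} {x : ℕ} : x ∈ ascParts p ↔ x ∈ p.parts := by
  rw [← coe_ascParts p, Multiset.mem_coe]

theorem pairwise_ascParts {n : ℕ} (p : Nat.Partition n) : (ascParts p).Pairwise (· ≤ ·) := by
  rw [ascParts, List.pairwise_reverse]
  exact Multiset.pairwise_sort _ _

theorem sum_ascParts {n : ℕ} (p : Nat.Partition n) : (ascParts p).sum = n := by
  rw [← Multiset.sum_coe, coe_ascParts, p.parts_sum]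

theorem onlyEvenRepeat_iff {n : ℕ} (p : Nat.Partition n) :
    OnlyEvenRepeat p ↔ (ascParts p).IsChain Step₂ := by
  rw [isChain_step₂_iff, and_iff_right (pairwise_ascParts p), OnlyEvenRepeat, ← coe_ascParts p]
  simp

theorem smallGaps_iff {n : ℕ} (p : Nat.Partition n) : SmallGaps p ↔
    (ascParts p).IsChain (fun a b => b ≤ a + 4 ∧ (2 ∣ b ∨ 2 ∣ a → b < a + 4)) := by
  rw [ascParts, List.isChain_reverse]
  rfl

theorem smallestLtFour_iff {n : ℕ} (p : Nat.Partition n) :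
    SmallestLtFour p ↔ ∀ x ∈ (ascParts p).head?, x < 4 := by
  have hs := pairwise_ascParts p
  simp only [SmallestLtFour, ← mem_ascParts]
  cases h : ascParts p with
  | nil => simp
  | cons a l =>
    rw [h, List.pairwise_cons] at hs
    simp only [List.head?_cons, Option.mem_some_iff, forall_eq']
    constructor
    · intro H
      refine H a List.mem_cons_self fun y hy => ?_
      rcases List.mem_cons.1 hy with rfl | hy
      exacts [le_rfl, hs.1 y hy]
    · intro H x _ hx
      exact (hx a List.mem_cons_self).trans_lt H

theorem mem_A₁_iff {n : ℕ} (p : Nat.Partition n) : p ∈ A₁ n ↔ ascParts p ∈ lists₁ n := by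
  have hpos : ∀ x ∈ ascParts p, 0 < x := fun x hx => p.parts_pos (mem_ascParts.1 hx)
  simp only [A₁, lists₁, Set.mem_ofPred_eq, onlyEvenRepeat_iff, smallGaps_iff, smallestLtFour_iff,
    isChain_zero_cons_step₁_iff, sum_ascParts, and_true, and_iff_left_of_imp fun _ => hpos]
  rw [isChain_step₁_iff, and_assoc]

theorem mem_A₂_iff {n : ℕ} (p : Nat.Partition n) : p ∈ A₂ n ↔ ascParts p ∈ lists₂ n := by
  simp only [A₂, lists₂, Set.mem_ofPred_eq, onlyEvenRepeat_iff, isChain_zero_cons_step₂_iff,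
    sum_ascParts, and_true, mem_ascParts]
  exact and_comm

/-- The partition whose parts are the entries of a list of positive numbers. -/
def ofPosList {n : ℕ} (l : List ℕ) (hpos : ∀ x ∈ l, 0 < x) (hsum : l.sum = n) :
    Nat.Partition n where
  parts := l
  parts_pos := fun h => hpos _ (Multiset.mem_coe.1 h)
  parts_sum := by rw [Multiset.sum_coe, hsum]

theorem ascParts_ofPosList {n : ℕ} {l : List ℕ} (hpos : ∀ x ∈ l, 0 < x) (hsum : l.sum = n)
    (hl : l.Pairwise (· ≤ ·)) : ascParts (ofPosList l hpos hsum) = l :=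
  (Multiset.coe_eq_coe.1 (coe_ascParts (ofPosList l hpos hsum))).eq_of_pairwise
    (fun _ _ _ _ => le_antisymm) (pairwise_ascParts _) hl

theorem ascParts_injective {n : ℕ} :
    Function.Injective (ascParts : Nat.Partition n → List ℕ) := fun p q h =>
  Nat.Partition.ext (by rw [← coe_ascParts p, ← coe_ascParts q, h])

theorem pairwise_of_isChain_zero_cons {l : List ℕ} (h : (0 :: l).IsChain Step₂) :
    l.Pairwise (· ≤ ·) :=
  ((isChain_step₂_iff l).1 ((isChain_zero_cons_step₂_iff l).1 h)).1

/-- A set of partitions cut out by a condition on the ascending list of parts is in bijection with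
the set of lists that satisfy the condition. -/
noncomputable def ascPartsEquiv {n : ℕ} (A : Set (Nat.Partition n)) (S : Set (List ℕ))
    (hA : ∀ p, p ∈ A ↔ ascParts p ∈ S)
    (hS : ∀ l ∈ S, l.Pairwise (· ≤ ·) ∧ (∀ x ∈ l, 0 < x) ∧ l.sum = n) : A ≃ S :=
  Equiv.ofBijective (fun p => ⟨ascParts p.1, (hA p.1).1 p.2⟩)
    ⟨fun _ _ h => Subtype.ext (ascParts_injective (congrArg Subtype.val h)), fun ⟨l, hl⟩ => by
      obtain ⟨h1, h2, h3⟩ := hS l hl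
      have h := ascParts_ofPosList h2 h3 h1
      exact ⟨⟨ofPosList l h2 h3, (hA _).2 (by rwa [h])⟩, Subtype.ext h⟩⟩

/-- A partition in `𝒜₁(n)` is determined by its ascending list of parts. -/
noncomputable def equivLists₁ (n : ℕ) : A₁ n ≃ lists₁ n :=
  ascPartsEquiv _ _ mem_A₁_iff fun _ hl =>
    ⟨pairwise_of_isChain_zero_cons ((isChain_step₁_iff _).1 hl.1).1, hl.2.1, hl.2.2⟩

/-- A partition in `𝒜₂(n)` is determined by its ascending list of parts. -/
noncomputable def equivLists₂ (n : ℕ) : A₂ n ≃ lists₂ n :=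
  ascPartsEquiv _ _ mem_A₂_iff fun _ hl => ⟨pairwise_of_isChain_zero_cons hl.1,
    fun x hx => Nat.pos_of_ne_zero fun h => hl.2.1 x hx (h ▸ dvd_zero 4), hl.2.2⟩

/-! ### The two encodings of partitions by letters and multiplicities -/

/-- A code is a list of pairs `(c, k)` where the letter `c` is a nonzero residue modulo `4` and `k`
is any natural number. -/
def IsCode (x : List (ℕ × ℕ)) : Prop := ∀ y ∈ x, 0 < y.1 ∧ y.1 < 4

theorem isCode_cons {c k : ℕ} {x : List (ℕ × ℕ)} :
    IsCode ((c, k) :: x) ↔ (0 < c ∧ c < 4) ∧ IsCode x := by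
  simp [IsCode]

/-- The least number congruent to `c` modulo `4` that may follow `p`: it is at least `p`, and
greater than `p` if `p` is odd. The letter `c` is meant to be `1`, `2` or `3`. -/
def next (p c : ℕ) : ℕ :=
  if p % 4 < c ∨ p % 4 = c ∧ c = 2 then 4 * (p / 4) + c else 4 * (p / 4) + c + 4

/-- The least multiple of `4` that is at least `v`. -/
def ceil4 (v : ℕ) : ℕ := 4 * ((v + 3) / 4)

/-- The list of a code for `𝒜₁`, continued after the value `p`: each pair `(c, k)` contributes the
least admissible part congruent to `c`, followed by `k` copies of the next multiple of `4`. -/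
def encode₁ : ℕ → List (ℕ × ℕ) → List ℕ
  | _, [] => []
  | p, (c, k) :: x => next p c ::
      (List.replicate k (ceil4 (next p c)) ++
        encode₁ (if k = 0 then next p c else ceil4 (next p c)) x)

/-- The inverse of `encode₁`: every entry that is not a multiple of `4` yields its residue together
with the number of multiples of `4` that immediately follow it. -/
def decode₁ : List ℕ → List (ℕ × ℕ)
  | [] => []
  | v :: l => if 4 ∣ v then decode₁ l else (v % 4, (l.takeWhile (4 ∣ ·)).length) :: decode₁ l

/-- The list of a code for `𝒜₂`, continued after the value `p`: each pair `(c, m)` contributes the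
least admissible part congruent to `c`, raised by `4 * m`. -/
def encode₂ : ℕ → List (ℕ × ℕ) → List ℕ
  | _, [] => []
  | p, (c, m) :: x => (next p c + 4 * m) :: encode₂ (next p c + 4 * m) x

/-- The inverse of `encode₂ p`. -/
def decode₂ : ℕ → List ℕ → List (ℕ × ℕ)
  | _, [] => []
  | p, v :: l => (v % 4, (v - next p (v % 4)) / 4) :: decode₂ v l

theorem next_mod {p c : ℕ} (hc : c < 4) : next p c % 4 = c := by
  unfold next; split_ifs <;> omega

theorem not_dvd_next {p c : ℕ} (h : 0 < c ∧ c < 4) : ¬ 4 ∣ next p c := by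
  have := next_mod (p := p) h.2
  omega

theorem dvd_ceil4 (v : ℕ) : 4 ∣ ceil4 v := dvd_mul_right _ _

theorem step₁_next {p c : ℕ} (h : 0 < c ∧ c < 4) : Step₁ p (next p c) := by
  unfold Step₁ Step₂ next; split_ifs <;> omega

theorem step₁_ceil4 (v : ℕ) : Step₁ v (ceil4 v) := by
  unfold Step₁ Step₂ ceil4; omega

theorem next_mod_of_step₁ {p v : ℕ} (h : Step₁ p v) (hv : ¬ 4 ∣ v) : next p (v % 4) = v := by
  unfold Step₁ Step₂ at h; unfold next; split_ifs <;> omega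

theorem ceil4_of_step₁ {p v : ℕ} (h : Step₁ p v) (hv : 4 ∣ v) : ceil4 p = v := by
  unfold Step₁ Step₂ at h; unfold ceil4; omega

theorem ceil4_of_dvd {v : ℕ} (hv : 4 ∣ v) : ceil4 v = v := by
  unfold ceil4; omega

theorem step₂_next_add {p c : ℕ} (m : ℕ) (h : 0 < c ∧ c < 4) : Step₂ p (next p c + 4 * m) := by
  unfold Step₂ next; split_ifs <;> omega

theorem next_add_of_step₂ {p v : ℕ} (h : Step₂ p v) (hv : ¬ 4 ∣ v) :
    next p (v % 4) + 4 * ((v - next p (v % 4)) / 4) = v := by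
  unfold Step₂ at h; unfold next; split_ifs <;> omega

theorem isChain_encode₁ {x : List (ℕ × ℕ)} (hx : IsCode x) (p : ℕ) :
    (p :: encode₁ p x).IsChain Step₁ := by
  have rep : ∀ (z k : ℕ) (l : List ℕ), 4 ∣ z → (z :: l).IsChain Step₁ →
      (z :: (List.replicate k z ++ l)).IsChain Step₁ := by
    intro z k l hz hl
    induction k with
    | zero => simpa
    | succ k ih =>
      rw [List.replicate_succ, List.cons_append, List.isChain_cons_cons]
      exact ⟨by unfold Step₁ Step₂; omega, ih⟩
  induction x generalizing p with
  | nil => simp [encode₁]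
  | cons y x ih =>
    obtain ⟨c, k⟩ := y
    rw [isCode_cons] at hx
    obtain ⟨hc, hx⟩ := hx
    rw [encode₁, List.isChain_cons_cons]
    refine ⟨step₁_next hc, ?_⟩
    cases k with
    | zero => simpa using ih hx (next p c)
    | succ k =>
      rw [List.replicate_succ, List.cons_append, List.isChain_cons_cons]
      exact ⟨step₁_ceil4 _, rep _ _ _ (dvd_ceil4 _) (by simpa using ih hx (ceil4 (next p c)))⟩

theorem encode₁_pos {x : List (ℕ × ℕ)} (hx : IsCode x) (p : ℕ) : ∀ v ∈ encode₁ p x, 0 < v := by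
  induction x generalizing p with
  | nil => simp [encode₁]
  | cons y x ih =>
    obtain ⟨c, k⟩ := y
    obtain ⟨hc, hx⟩ := isCode_cons.1 hx
    have h0 : 0 < next p c := by
      have := next_mod (p := p) hc.2
      omega
    have h1 : 0 < ceil4 (next p c) := by unfold ceil4; omega
    intro v hv
    rw [encode₁, List.mem_cons, List.mem_append] at hv
    rcases hv with rfl | hv | hv
    · exact h0
    · rwa [List.eq_of_mem_replicate hv]
    · exact ih hx _ v hv

theorem takeWhile_encode₁ {x : List (ℕ × ℕ)} (hx : IsCode x) (p : ℕ) :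
    (encode₁ p x).takeWhile (4 ∣ ·) = [] := by
  rcases x with _ | ⟨⟨c, k⟩, x⟩
  · rfl
  · rw [encode₁, List.takeWhile_cons_of_neg]
    simpa using not_dvd_next (isCode_cons.1 hx).1

theorem decode₁_encode₁ {x : List (ℕ × ℕ)} (hx : IsCode x) (p : ℕ) :
    decode₁ (encode₁ p x) = x := by
  have rep : ∀ (z k : ℕ) (l : List ℕ), 4 ∣ z →
      decode₁ (List.replicate k z ++ l) = decode₁ l := by
    intro z k l hz
    induction k with
    | zero => simp
    | succ k ih => rw [List.replicate_succ, List.cons_append, decode₁, if_pos hz, ih]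
  induction x generalizing p with
  | nil => rfl
  | cons y x ih =>
    obtain ⟨c, k⟩ := y
    obtain ⟨hc, hx⟩ := isCode_cons.1 hx
    rw [encode₁, decode₁, if_neg (not_dvd_next hc), rep _ _ _ (dvd_ceil4 _), ih hx,
      next_mod hc.2, List.takeWhile_append_of_pos, takeWhile_encode₁ hx]
    · simp
    · intro a ha
      rw [List.eq_of_mem_replicate ha]
      simpa using dvd_ceil4 _

theorem isCode_decode₁ (l : List ℕ) : IsCode (decode₁ l) := by
  induction l with
  | nil => simp [decode₁, IsCode]
  | cons v l ih =>
    rw [decode₁]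
    split_ifs with h
    · exact ih
    · exact isCode_cons.2 ⟨by omega, ih⟩

/-- Decoding loses the multiples of `4` at the front of the list, which have to be put back. -/
theorem replicate_append_encode₁_decode₁ {p : ℕ} {l : List ℕ} (hl : (p :: l).IsChain Step₁) :
    List.replicate (l.takeWhile (4 ∣ ·)).length (ceil4 p) ++
      encode₁ (if (l.takeWhile (4 ∣ ·)).length = 0 then p else ceil4 p) (decode₁ l) = l := by
  induction l generalizing p with
  | nil => rfl
  | cons v l ih =>
    rw [List.isChain_cons_cons] at hl
    have ih := ih hl.2
    by_cases hv : 4 ∣ v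
    · rw [List.takeWhile_cons_of_pos (by simpa using hv), decode₁, if_pos hv, List.length_cons,
        if_neg (Nat.succ_ne_zero _), ceil4_of_step₁ hl.1 hv, List.replicate_succ,
        List.cons_append]
      rw [ceil4_of_dvd hv, ite_self] at ih
      rw [ih]
    · rw [List.takeWhile_cons_of_neg (by simpa using hv), decode₁, if_neg hv]
      simp only [List.length_nil, List.replicate_zero, List.nil_append, if_true]
      rw [encode₁, next_mod_of_step₁ hl.1 hv, ih]

theorem encode₁_decode₁ {l : List ℕ} (hl : (0 :: l).IsChain Step₁) (hpos : ∀ x ∈ l, 0 < x) :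
    encode₁ 0 (decode₁ l) = l := by
  have h := replicate_append_encode₁_decode₁ hl
  have hk : (l.takeWhile (4 ∣ ·)).length = 0 := by
    by_contra hk
    have h0 : (0 : ℕ) ∈ l := by
      rw [← h, List.mem_append]
      exact Or.inl (List.mem_replicate.2 ⟨hk, rfl⟩)
    exact (hpos 0 h0).false
  rw [hk] at h
  simpa using h

theorem isChain_encode₂ {x : List (ℕ × ℕ)} (hx : IsCode x) (p : ℕ) :
    (p :: encode₂ p x).IsChain Step₂ := by
  induction x generalizing p with
  | nil => simp [encode₂]
  | cons y x ih =>
    obtain ⟨c, m⟩ := y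
    obtain ⟨hc, hx⟩ := isCode_cons.1 hx
    rw [encode₂, List.isChain_cons_cons]
    exact ⟨step₂_next_add m hc, ih hx _⟩

theorem not_dvd_encode₂ {x : List (ℕ × ℕ)} (hx : IsCode x) (p : ℕ) :
    ∀ v ∈ encode₂ p x, ¬ 4 ∣ v := by
  induction x generalizing p with
  | nil => simp [encode₂]
  | cons y x ih =>
    obtain ⟨c, m⟩ := y
    obtain ⟨hc, hx⟩ := isCode_cons.1 hx
    intro v hv
    rw [encode₂, List.mem_cons] at hv
    rcases hv with rfl | hv
    · have := not_dvd_next (p := p) hc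
      omega
    · exact ih hx _ v hv

theorem decode₂_encode₂ {x : List (ℕ × ℕ)} (hx : IsCode x) (p : ℕ) :
    decode₂ p (encode₂ p x) = x := by
  induction x generalizing p with
  | nil => rfl
  | cons y x ih =>
    obtain ⟨c, m⟩ := y
    obtain ⟨hc, hx⟩ := isCode_cons.1 hx
    have h : (next p c + 4 * m) % 4 = c := by
      rw [Nat.add_mul_mod_self_left, next_mod hc.2]
    rw [encode₂, decode₂, h, ih hx]
    congr 2
    omega

theorem isCode_decode₂ {l : List ℕ} (hl : ∀ v ∈ l, ¬ 4 ∣ v) (p : ℕ) : IsCode (decode₂ p l) := by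
  induction l generalizing p with
  | nil => simp [decode₂, IsCode]
  | cons v l ih =>
    rw [List.forall_mem_cons] at hl
    exact isCode_cons.2 ⟨by omega, ih hl.2 _⟩

theorem encode₂_decode₂ {p : ℕ} {l : List ℕ} (hl : (p :: l).IsChain Step₂)
    (h4 : ∀ v ∈ l, ¬ 4 ∣ v) : encode₂ p (decode₂ p l) = l := by
  induction l generalizing p with
  | nil => rfl
  | cons v l ih =>
    rw [List.isChain_cons_cons] at hl
    rw [List.forall_mem_cons] at h4
    rw [decode₂, encode₂, next_add_of_step₂ hl.1 h4.1, ih hl.2 h4.2]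

/-- A statistic that depends only on the residue modulo `4` and ignores multiples of `4` can be read
off the letters of a code. -/
theorem countP_encode₁ {q : ℕ → Bool} (hq : ∀ v, q (v % 4) = q v) (h0 : q 0 = false)
    {x : List (ℕ × ℕ)} (hx : IsCode x) (p : ℕ) :
    (encode₁ p x).countP q = (x.map Prod.fst).countP q := by
  induction x generalizing p with
  | nil => rfl
  | cons y x ih =>
    obtain ⟨c, k⟩ := y
    obtain ⟨hc, hx⟩ := isCode_cons.1 hx
    have h1 : q (next p c) = q c := by rw [← hq, next_mod hc.2]
    have h2 : q (ceil4 (next p c)) = false := by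
      rw [← hq, Nat.mod_eq_zero_of_dvd (dvd_ceil4 _), h0]
    simp [encode₁, List.countP_cons, ih hx, h1, h2, List.countP_replicate]

theorem countP_encode₂ {q : ℕ → Bool} (hq : ∀ v, q (v % 4) = q v)
    {x : List (ℕ × ℕ)} (hx : IsCode x) (p : ℕ) :
    (encode₂ p x).countP q = (x.map Prod.fst).countP q := by
  induction x generalizing p with
  | nil => rfl
  | cons y x ih =>
    obtain ⟨c, k⟩ := y
    obtain ⟨hc, hx⟩ := isCode_cons.1 hx
    have h1 : q (next p c + 4 * k) = q c := by
      rw [← hq, Nat.add_mul_mod_self_left, next_mod hc.2]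
    simp [encode₂, List.countP_cons, ih hx, h1]

/-! ### The bijection on multiplicities for fixed letters -/

/-- The number of units of `4` that multiplicities `k₁, k₂, …` of multiples of `4` add to a partition
with given letters. The slot after a letter is marked `true` if putting a multiple of `4` there
raises all later letters by `4`, and `h` is a quarter of the multiple of `4` that fits into the
first slot. -/
def slotWeight : ℕ → List Bool → List ℕ → ℕ
  | _, [], _ => 0
  | _, _ :: _, [] => 0
  | h, false :: t, k :: ks => k * h + slotWeight (h + 1) t ks
  | h, true :: t, 0 :: ks => slotWeight h t ks
  | h, true :: t, (k + 1) :: ks => (k + 1) * h + t.length + slotWeight (h + 1) t ks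

/-- The weighted sum of a list in which the last entry has weight `h`, the last but one `h + 1`, and
so on. -/
def stairWeight (h : ℕ) : List ℕ → ℕ
  | [] => 0
  | m :: ms => (h + ms.length) * m + stairWeight h ms

theorem stairWeight_append_singleton (h : ℕ) (l : List ℕ) (a : ℕ) :
    stairWeight h (l ++ [a]) = stairWeight (h + 1) l + h * a := by
  induction l with
  | nil => simp [stairWeight]
  | cons m l ih =>
    simp only [List.cons_append, stairWeight, ih, List.length_append, List.length_singleton]
    ring

/-- The map from slot multiplicities to excesses. It does not involve the height `h`, but it turns
`slotWeight h` into `stairWeight h` for every `h`. -/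
def slotMap : List Bool → List ℕ → List ℕ
  | [], _ => []
  | _ :: _, [] => []
  | false :: t, k :: ks => slotMap t ks ++ [k]
  | true :: t, 0 :: ks => 0 :: slotMap t ks
  | true :: t, (k + 1) :: ks => (slotMap t ks ++ [k]).modifyHead (· + 1)

/-- The inverse of `slotMap`. -/
def slotInv : List Bool → List ℕ → List ℕ
  | [], _ => []
  | _ :: _, [] => []
  | false :: t, m :: ms => (m :: ms).getLastD 0 :: slotInv t (m :: ms).dropLast
  | true :: t, 0 :: ms => 0 :: slotInv t ms
  | true :: t, (m + 1) :: ms => ((m :: ms).getLastD 0 + 1) :: slotInv t (m :: ms).dropLast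

theorem length_slotMap {t : List Bool} {k : List ℕ} (h : k.length = t.length) :
    (slotMap t k).length = t.length := by
  induction t, k using slotMap.induct <;> simp_all [slotMap]

theorem length_slotInv {t : List Bool} {m : List ℕ} (h : m.length = t.length) :
    (slotInv t m).length = t.length := by
  induction t, m using slotInv.induct <;> simp_all [slotInv]

theorem slotInv_slotMap {t : List Bool} {k : List ℕ} (h : k.length = t.length) :
    slotInv t (slotMap t k) = k := by
  have key : ∀ (l : List ℕ) (a : ℕ) (t : List Bool),
      slotInv (false :: t) (l ++ [a]) = a :: slotInv t l ∧
      slotInv (true :: t) ((l ++ [a]).modifyHead (· + 1)) = (a + 1) :: slotInv t l := by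
    intro l a t
    cases l with
    | nil => simp [slotInv]
    | cons b l =>
      constructor
      · rw [List.cons_append, slotInv, ← List.cons_append,
          List.dropLast_concat, List.getLastD_concat]
      · rw [List.cons_append, List.modifyHead_cons, slotInv, ← List.cons_append,
          List.dropLast_concat, List.getLastD_concat]
  induction t, k using slotMap.induct <;> simp_all [slotMap]
  all_goals simp_all [slotInv]

theorem slotMap_slotInv {t : List Bool} {m : List ℕ} (h : m.length = t.length) :
    slotMap t (slotInv t m) = m := by
  have key : ∀ (a : ℕ) (l : List ℕ), (a :: l).dropLast ++ [(a :: l).getLastD 0] = a :: l := by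
    intro a l
    rw [List.getLastD_eq_getLast?, List.getLast?_eq_some_getLast (List.cons_ne_nil a l)]
    exact List.dropLast_append_getLast _
  induction t, m using slotInv.induct with
  | case1 => simp_all [slotMap]
  | case2 => simp_all
  | case3 t m ms ih => rw [slotInv, slotMap, ih (by simpa using h), key]
  | case4 t ms ih => rw [slotInv, slotMap, ih (by simpa using h)]
  | case5 t m ms ih => rw [slotInv, slotMap, ih (by simpa using h), key, List.modifyHead_cons]

theorem stairWeight_slotMap {t : List Bool} {k : List ℕ} (hk : k.length = t.length) (h : ℕ) :
    stairWeight h (slotMap t k) = slotWeight h t k := by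
  have key : ∀ (h : ℕ) (l : List ℕ) (a : ℕ), stairWeight h ((l ++ [a]).modifyHead (· + 1)) =
      stairWeight h (l ++ [a]) + h + l.length := by
    intro h l a
    cases l with
    | nil => simp [stairWeight]; ring
    | cons b l => simp [stairWeight]; ring
  induction t, k using slotMap.induct generalizing h with
  | case1 => simp [slotMap, stairWeight, slotWeight]
  | case2 => simp_all
  | case3 t k ks ih =>
    rw [slotMap, stairWeight_append_singleton, ih (by simpa using hk), slotWeight]
    ring
  | case4 t ks ih =>
    rw [slotMap, stairWeight, ih (by simpa using hk), slotWeight]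
    ring
  | case5 t k ks ih =>
    have hk : ks.length = t.length := by simpa using hk
    rw [slotMap, key, stairWeight_append_singleton, ih hk, slotWeight, length_slotMap hk]
    ring

/-! ### Sizes of the encoded partitions -/

/-- The size of the smallest partition, continued after `p`, with given letters. -/
def baseSum : ℕ → List ℕ → ℕ
  | _, [] => 0
  | p, c :: u => next p c + baseSum (next p c) u

/-- Marks the slot after each letter `c` by whether the following letter can be reached from `c`
without passing a multiple of `4`. There is no letter to raise after the last one, and its mark
could be either. -/
def slotTypes : List ℕ → List Bool
  | [] => []
  | [_] => [false]
  | c :: c' :: u => decide (c < c' ∨ c = c' ∧ c' = 2) :: slotTypes (c' :: u)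

theorem length_slotTypes (u : List ℕ) : (slotTypes u).length = u.length := by
  induction u using slotTypes.induct <;> simp_all [slotTypes]

theorem next_add_four_mul (p c j : ℕ) : next (p + 4 * j) c = next p c + 4 * j := by
  unfold next; split_ifs <;> omega

theorem baseSum_add_four_mul (p j : ℕ) (u : List ℕ) :
    baseSum (p + 4 * j) u = baseSum p u + 4 * (j * u.length) := by
  induction u generalizing p with
  | nil => simp [baseSum]
  | cons c u ih =>
    rw [baseSum, baseSum, next_add_four_mul, ih, List.length_cons]
    ring

theorem sum_encode₂ (p : ℕ) (x : List (ℕ × ℕ)) :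
    (encode₂ p x).sum = baseSum p (x.map Prod.fst) + 4 * stairWeight 1 (x.map Prod.snd) := by
  induction x generalizing p with
  | nil => simp [encode₂, baseSum, stairWeight]
  | cons y x ih =>
    obtain ⟨c, m⟩ := y
    simp only [encode₂, List.sum_cons, ih, baseSum_add_four_mul, List.map_cons, baseSum,
      stairWeight, List.length_map]
    ring

theorem sum_encode₁_cons (p c k : ℕ) {x : List (ℕ × ℕ)} (hx : IsCode ((c, k) :: x)) :
    (encode₁ p ((c, k) :: x)).sum = baseSum p (c :: x.map Prod.fst) +
      4 * slotWeight (next p c / 4 + 1) (slotTypes (c :: x.map Prod.fst))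
        (k :: x.map Prod.snd) := by
  induction x generalizing p c k with
  | nil =>
    have hc := (isCode_cons.1 hx).1
    have h1 := next_mod (p := p) hc.2
    have h2 : ceil4 (next p c) = 4 * (next p c / 4 + 1) := by unfold ceil4; omega
    simp only [encode₁, List.sum_cons, List.append_nil, List.sum_replicate, smul_eq_mul, h2,
      List.map_nil, baseSum, slotTypes, slotWeight]
    ring
  | cons y x ih =>
    obtain ⟨c', k'⟩ := y
    obtain ⟨hc, hx⟩ := isCode_cons.1 hx
    have hc' := (isCode_cons.1 hx).1
    simp only [List.map_cons]
    rw [encode₁, List.sum_cons, List.sum_append, ih _ _ _ hx, List.sum_replicate, smul_eq_mul,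
      show ∀ u, baseSum p (c :: u) = next p c + baseSum (next p c) u from fun _ => rfl, slotTypes]
    have h1 := next_mod (p := p) hc.2
    generalize next p c = v at h1
    have h2 : ceil4 v = 4 * (v / 4 + 1) := by unfold ceil4; omega
    have h3 : next (ceil4 v) c' = 4 * (v / 4) + c' + 4 := by
      unfold next; rw [h2]; split_ifs <;> omega
    by_cases ht : c < c' ∨ c = c' ∧ c' = 2
    · have h4 : next v c' = 4 * (v / 4) + c' := by unfold next; rw [h1, if_pos ht]
      rw [decide_eq_true ht]
      cases k with
      | zero =>
        rw [if_pos rfl, slotWeight, h4, show (4 * (v / 4) + c') / 4 = v / 4 by omega]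
        ring
      | succ k =>
        rw [if_neg (Nat.succ_ne_zero k), slotWeight, length_slotTypes, baseSum, baseSum, h3, h4,
          show 4 * (v / 4) + c' + 4 = 4 * (v / 4) + c' + 4 * 1 by ring, baseSum_add_four_mul,
          show (4 * (v / 4) + c' + 4 * 1) / 4 = v / 4 + 1 by omega, h2, List.length_cons]
        ring
    · have h4 : next v c' = 4 * (v / 4) + c' + 4 := by unfold next; rw [h1, if_neg ht]
      have h5 : next (if k = 0 then v else ceil4 v) c' = 4 * (v / 4) + c' + 4 := by
        split_ifs <;> assumption
      rw [decide_eq_false ht, slotWeight, baseSum, baseSum, h5, h4, h2,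
        show (4 * (v / 4) + c' + 4) / 4 = v / 4 + 1 by omega]
      ring

theorem sum_encode₁ {x : List (ℕ × ℕ)} (hx : IsCode x) :
    (encode₁ 0 x).sum = baseSum 0 (x.map Prod.fst) +
      4 * slotWeight 1 (slotTypes (x.map Prod.fst)) (x.map Prod.snd) := by
  rcases x with _ | ⟨⟨c, k⟩, x⟩
  · rfl
  · obtain ⟨hc, -⟩ := isCode_cons.1 hx
    rw [sum_encode₁_cons 0 c k hx, show next 0 c / 4 = 0 by unfold next; split_ifs <;> omega]
    rfl

/-! ### The bijection between partitions -/

/-- Replaces the multiplicities of a code by their images under a map that depends on the types of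
the slots between the letters. -/
def mapCode (F : List Bool → List ℕ → List ℕ) (x : List (ℕ × ℕ)) : List (ℕ × ℕ) :=
  (x.map Prod.fst).zip (F (slotTypes (x.map Prod.fst)) (x.map Prod.snd))

section mapCode

variable {F G : List Bool → List ℕ → List ℕ}

theorem map_fst_mapCode (hF : ∀ {t k}, k.length = t.length → (F t k).length = t.length)
    (x : List (ℕ × ℕ)) : (mapCode F x).map Prod.fst = x.map Prod.fst :=
  List.map_fst_zip (by rw [hF] <;> simp [length_slotTypes])

theorem map_snd_mapCode (hF : ∀ {t k}, k.length = t.length → (F t k).length = t.length)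
    (x : List (ℕ × ℕ)) :
    (mapCode F x).map Prod.snd = F (slotTypes (x.map Prod.fst)) (x.map Prod.snd) :=
  List.map_snd_zip (by rw [hF] <;> simp [length_slotTypes])

theorem isCode_iff (x : List (ℕ × ℕ)) : IsCode x ↔ ∀ c ∈ x.map Prod.fst, 0 < c ∧ c < 4 := by
  rw [List.forall_mem_map]
  rfl

theorem isCode_mapCode (hF : ∀ {t k}, k.length = t.length → (F t k).length = t.length)
    {x : List (ℕ × ℕ)} (hx : IsCode x) : IsCode (mapCode F x) := by
  rwa [isCode_iff, map_fst_mapCode hF, ← isCode_iff]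

theorem mapCode_mapCode (hF : ∀ {t k}, k.length = t.length → (F t k).length = t.length)
    (hGF : ∀ {t k}, k.length = t.length → G t (F t k) = k) (x : List (ℕ × ℕ)) :
    mapCode G (mapCode F x) = x := by
  rw [mapCode, map_fst_mapCode hF, map_snd_mapCode hF, hGF (by simp [length_slotTypes])]
  exact (List.zip_of_prod rfl rfl).symm

end mapCode

theorem sum_encode₂_mapCode {x : List (ℕ × ℕ)} (hx : IsCode x) :
    (encode₂ 0 (mapCode slotMap x)).sum = (encode₁ 0 x).sum := by
  rw [sum_encode₂, sum_encode₁ hx, map_fst_mapCode length_slotMap, map_snd_mapCode length_slotMap,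
    stairWeight_slotMap (by simp [length_slotTypes])]

theorem sum_encode₁_mapCode {x : List (ℕ × ℕ)} (hx : IsCode x) :
    (encode₁ 0 (mapCode slotInv x)).sum = (encode₂ 0 x).sum := by
  rw [← sum_encode₂_mapCode (isCode_mapCode length_slotInv hx),
    mapCode_mapCode length_slotInv slotMap_slotInv]

/-- The bijection between the lists of parts: decode, apply `slotMap` to the multiplicities, and
encode again. -/
def listEquiv (n : ℕ) : lists₁ n ≃ lists₂ n where
  toFun l := ⟨encode₂ 0 (mapCode slotMap (decode₁ l.1)), by
    have h := isCode_decode₁ l.1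
    have h' := isCode_mapCode length_slotMap h
    refine ⟨isChain_encode₂ h' 0, not_dvd_encode₂ h' 0, ?_⟩
    rw [sum_encode₂_mapCode h, encode₁_decode₁ l.2.1 l.2.2.1, l.2.2.2]⟩
  invFun l := ⟨encode₁ 0 (mapCode slotInv (decode₂ 0 l.1)), by
    have h := isCode_decode₂ l.2.2.1 0
    have h' := isCode_mapCode length_slotInv h
    refine ⟨isChain_encode₁ h' 0, encode₁_pos h' 0, ?_⟩
    rw [sum_encode₁_mapCode h, encode₂_decode₂ l.2.1 l.2.2.1, l.2.2.2]⟩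
  left_inv l := Subtype.ext (by
    dsimp only
    rw [decode₂_encode₂ (isCode_mapCode length_slotMap (isCode_decode₁ _)),
      mapCode_mapCode length_slotMap slotInv_slotMap, encode₁_decode₁ l.2.1 l.2.2.1])
  right_inv l := Subtype.ext (by
    dsimp only
    rw [decode₁_encode₁ (isCode_mapCode length_slotInv (isCode_decode₂ l.2.2.1 0)),
      mapCode_mapCode length_slotInv slotMap_slotInv, encode₂_decode₂ l.2.1 l.2.2.1])

theorem countP_listEquiv {n : ℕ} {q : ℕ → Bool} (hq : ∀ v, q (v % 4) = q v) (h0 : q 0 = false)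
    (l : lists₁ n) : (listEquiv n l).1.countP q = l.1.countP q := by
  have h := isCode_decode₁ l.1
  change (encode₂ 0 (mapCode slotMap (decode₁ l.1))).countP q = _
  rw [countP_encode₂ hq (isCode_mapCode length_slotMap h), map_fst_mapCode length_slotMap,
    ← countP_encode₁ hq h0 h 0, encode₁_decode₁ l.2.1 l.2.2.1]

theorem countP_parts {n : ℕ} (p : Nat.Partition n) (q : ℕ → Prop) [DecidablePred q] :
    p.parts.countP q = (ascParts p).countP (q ·) := by
  rw [← coe_ascParts p, Multiset.coe_countP]

/-- The bijection between `𝒜₁(n)` and `𝒜₂(n)` given by `listEquiv`. -/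
noncomputable def partitionEquiv (n : ℕ) : A₁ n ≃ A₂ n :=
  (equivLists₁ n).trans ((listEquiv n).trans (equivLists₂ n).symm)

theorem countP_partitionEquiv {n : ℕ} (q : ℕ → Prop) [DecidablePred q]
    (hq : ∀ v, q (v % 4) ↔ q v) (h0 : ¬ q 0) (α : A₁ n) :
    (partitionEquiv n α).1.parts.countP q = α.1.parts.countP q := by
  have h : ascParts (partitionEquiv n α).1 = (listEquiv n (equivLists₁ n α)).1 :=
    congrArg Subtype.val ((equivLists₂ n).apply_symm_apply (listEquiv n (equivLists₁ n α)))
  rw [countP_parts, countP_parts, h]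
  exact countP_listEquiv (fun v => decide_eq_decide.2 (hq v)) (decide_eq_false h0) _

end EulerRefinement

theorem theorem2p4 (n : ℕ) :
    ∃ φ : EulerRefinement.A₁ n ≃ EulerRefinement.A₂ n,
      ∀ α : EulerRefinement.A₁ n,
        EulerRefinement.lo (α : Nat.Partition n) =
            EulerRefinement.lo (φ α : Nat.Partition n) ∧
          EulerRefinement.r₂ (α : Nat.Partition n) =
            EulerRefinement.r₂ (φ α : Nat.Partition n) :=
  ⟨EulerRefinement.partitionEquiv n, fun α =>
    ⟨(EulerRefinement.countP_partitionEquiv _ (fun v => by omega) (by omega) α).symm,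
      (EulerRefinement.countP_partitionEquiv _ (fun v => by omega) (by omega) α).symm⟩⟩
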